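/- Let $F$ be a field of characteristic different from $2$, and let $A$ be a Novikov algebra over $F$, that is, a (not necessarily associative or unital) $F$-algebra satisfying $(x,y,z)=(y,x,z)$ and $(xy)z=(xz)y$ for all $x,y,z\in A$, where $(x,y,z)=(xy)z-x(yz)$. Put $A^{(0)_L}=A$ and let $A^{(n+1)_L}$ be the subspace spanned by all commutators $xy-yx$ with $x,y\in A^{(n)_L}$; assume that $A$ is Lie-solvable, i.e. $A^{(n)_L}=0$ for some $n\ge 0$. An ideal means a two-sided ideal that is an $F$-subspace, and an ideal $I$ is trivial if $xy=0$ for all $x,y\in I$. Let $\mathcal B_0(A)=0$; for every ordinal $\alpha$ let $\mathcal B_{\alpha+1}(A)$ be the preimage in $A$ of the sum of all trivial ideals of $A/\mathcal B_\alpha(A)$; and let $\mathcal B_\alpha(A)=\bigcup_{\beta<\alpha}\mathcal B_\beta(A)$ for limit ordinals $\alpha$. The Baer radical of $A$ is $\mathcal B(A)=\mathcal B_\delta(A)$, where $\delta$ is any ordinal whose cardinality is greater than $|A|$. Then $$\mathcal B(A)=\bigcap\{\,I \;:\; I \text{ is an ideal of } A \text{ and } A/I \text{ is an integral domain}\,\},$$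 where an integral domain is an associative and commutative (not necessarily unital) algebra without nonzero zero divisors. -/

import Mathlib

universe u v

/-- A (not necessarily unital, not necessarily associative) algebra is a *Novikov algebra* if it
satisfies `(x, y, z) = (y, x, z)`, where `(x, y, z) = (x y) z - x (y z)`,
and `(x y) z = (x z) y`. -/
class IsNovikov (A : Type u) [NonUnitalNonAssocRing A] : Prop where
  associator_left_symm : ∀ x y z : A, associator x y z = associator y x z
  mul_right_comm : ∀ x y z : A, (x * y) * z = (x * z) * y

/-- A two-sided ideal of a nonassociative `F`-algebra: a subspace closed under left and right
multiplication by elements of the algebra. -/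
structure AlgIdeal (F : Type v) (A : Type u) [Field F] [NonUnitalNonAssocRing A] [Module F A]
    extends Submodule F A where
  mul_mem_left' : ∀ a x : A, x ∈ carrier → a * x ∈ carrier
  mul_mem_right' : ∀ a x : A, x ∈ carrier → x * a ∈ carrier

namespace AlgIdeal

variable {F : Type v} {A : Type u} [Field F] [NonUnitalNonAssocRing A] [Module F A]

instance : SetLike (AlgIdeal F A) A where
  coe I := I.carrier
  coe_injective := by
    rintro ⟨I, _, _⟩ ⟨J, _, _⟩ h
    have : I = J := SetLike.coe_injective h
    subst this
    rfl

instance : PartialOrder (AlgIdeal F A) := .ofSetLike (AlgIdeal F A) A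

theorem mem_toSubmodule (I : AlgIdeal F A) (x : A) : x ∈ I.toSubmodule ↔ x ∈ I := Iff.rfl

theorem mul_mem_left (I : AlgIdeal F A) (a : A) {x : A} (hx : x ∈ I.toSubmodule) :
    a * x ∈ I.toSubmodule := I.mul_mem_left' a x hx

theorem mul_mem_right (I : AlgIdeal F A) (a : A) {x : A} (hx : x ∈ I.toSubmodule) :
    x * a ∈ I.toSubmodule := I.mul_mem_right' a x hx

/-- The zero ideal. -/
def zero (F : Type v) (A : Type u) [Field F] [NonUnitalNonAssocRing A] [Module F A] :
    AlgIdeal F A where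
  toSubmodule := ⊥
  mul_mem_left' a x hx := by
    have hx : x = 0 := hx
    subst hx
    exact mul_zero a
  mul_mem_right' a x hx := by
    have hx : x = 0 := hx
    subst hx
    exact zero_mul a

/-- The quotient algebra `A / I`. -/
def Quotient (I : AlgIdeal F A) : Type u := A ⧸ I.toSubmodule

instance (I : AlgIdeal F A) : AddCommGroup I.Quotient :=
  inferInstanceAs (AddCommGroup (A ⧸ I.toSubmodule))

instance (I : AlgIdeal F A) : Module F I.Quotient :=
  inferInstanceAs (Module F (A ⧸ I.toSubmodule))

/-- The canonical projection `A → A / I`, as a linear map. -/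
def proj (I : AlgIdeal F A) : A →ₗ[F] I.Quotient := I.toSubmodule.mkQ

theorem proj_surjective (I : AlgIdeal F A) : Function.Surjective I.proj :=
  Submodule.mkQ_surjective _

theorem proj_eq_zero (I : AlgIdeal F A) (x : A) : I.proj x = 0 ↔ x ∈ I :=
  Submodule.Quotient.mk_eq_zero _

/-- Multiplication of cosets: `(x + I) (y + I) = x y + I`. -/
instance (I : AlgIdeal F A) : Mul I.Quotient where
  mul := Quotient.map₂ (· * ·) (by
    intro a b hab c d hcd
    have hab := (Submodule.quotientRel_def _).1 hab
    have hcd := (Submodule.quotientRel_def _).1 hcd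
    refine (Submodule.quotientRel_def _).2 ?_
    have e : a * c - b * d = (a - b) * c + b * (c - d) := by
      rw [sub_mul, mul_sub]
      abel
    change a * c - b * d ∈ _
    rw [e]
    exact add_mem (I.mul_mem_right c hab) (I.mul_mem_left b hcd))

theorem proj_mul (I : AlgIdeal F A) (x y : A) : I.proj (x * y) = I.proj x * I.proj y := rfl

instance (I : AlgIdeal F A) : NonUnitalNonAssocRing I.Quotient where
  __ := (inferInstance : AddCommGroup I.Quotient)
  __ := (inferInstance : Mul I.Quotient)
  left_distrib a b c := by
    obtain ⟨a, rfl⟩ := I.proj_surjective a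
    obtain ⟨b, rfl⟩ := I.proj_surjective b
    obtain ⟨c, rfl⟩ := I.proj_surjective c
    simp only [← map_add, ← proj_mul, mul_add]
  right_distrib a b c := by
    obtain ⟨a, rfl⟩ := I.proj_surjective a
    obtain ⟨b, rfl⟩ := I.proj_surjective b
    obtain ⟨c, rfl⟩ := I.proj_surjective c
    simp only [← map_add, ← proj_mul, add_mul]
  zero_mul a := by
    obtain ⟨a, rfl⟩ := I.proj_surjective a
    rw [← map_zero I.proj, ← proj_mul, zero_mul]
  mul_zero a := by
    obtain ⟨a, rfl⟩ := I.proj_surjective a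
    rw [← map_zero I.proj, ← proj_mul, mul_zero]

instance (I : AlgIdeal F A) [IsScalarTower F A A] : IsScalarTower F I.Quotient I.Quotient where
  smul_assoc c x y := by
    obtain ⟨x, rfl⟩ := I.proj_surjective x
    obtain ⟨y, rfl⟩ := I.proj_surjective y
    simp only [smul_eq_mul, ← map_smul, ← proj_mul, smul_mul_assoc]

instance (I : AlgIdeal F A) [SMulCommClass F A A] : SMulCommClass F I.Quotient I.Quotient where
  smul_comm c x y := by
    obtain ⟨x, rfl⟩ := I.proj_surjective x
    obtain ⟨y, rfl⟩ := I.proj_surjective y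
    simp only [smul_eq_mul, ← map_smul, ← proj_mul, mul_smul_comm]

/-- The preimage in `A` of an ideal of `A / I`. -/
def preimage (I : AlgIdeal F A) (J : AlgIdeal F I.Quotient) : AlgIdeal F A where
  toSubmodule := J.toSubmodule.comap I.proj
  mul_mem_left' a _ hx := J.mul_mem_left (I.proj a) hx
  mul_mem_right' a _ hx := J.mul_mem_right (I.proj a) hx

theorem mem_preimage (I : AlgIdeal F A) (J : AlgIdeal F I.Quotient) (x : A) :
    x ∈ I.preimage J ↔ I.proj x ∈ J := Iff.rfl

variable [IsScalarTower F A A] [SMulCommClass F A A]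

/-- The sum of a set of ideals. -/
def sum (S : Set (AlgIdeal F A)) : AlgIdeal F A where
  toSubmodule := ⨆ I ∈ S, I.toSubmodule
  mul_mem_left' a x hx := by
    have h : (⨆ I ∈ S, I.toSubmodule) ≤ (⨆ I ∈ S, I.toSubmodule).comap (LinearMap.mulLeft F a) :=
      iSup₂_le fun I hI y hy =>
        (le_iSup₂ (f := fun (I : AlgIdeal F A) (_ : I ∈ S) => I.toSubmodule) I hI)
          (I.mul_mem_left a hy)
    exact h hx
  mul_mem_right' a x hx := by
    have h : (⨆ I ∈ S, I.toSubmodule) ≤ (⨆ I ∈ S, I.toSubmodule).comap (LinearMap.mulRight F a) :=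
      iSup₂_le fun I hI y hy =>
        (le_iSup₂ (f := fun (I : AlgIdeal F A) (_ : I ∈ S) => I.toSubmodule) I hI)
          (I.mul_mem_right a hy)
    exact h hx

theorem le_sum {S : Set (AlgIdeal F A)} {I : AlgIdeal F A} (hI : I ∈ S) : I ≤ sum S := fun _ hx =>
  (le_iSup₂ (f := fun (I : AlgIdeal F A) (_ : I ∈ S) => I.toSubmodule) I hI) hx

/-- An ideal `I` is *trivial* if it has zero multiplication, `I² = 0`. -/
def IsTrivial {F : Type v} {A : Type u} [Field F] [NonUnitalNonAssocRing A] [Module F A]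
    (I : AlgIdeal F A) : Prop :=
  ∀ x ∈ I, ∀ y ∈ I, x * y = 0

end AlgIdeal

section

variable (F : Type v) (A : Type u) [Field F] [NonUnitalNonAssocRing A] [Module F A]

/-- The Lie-solvable powers of `A`: the first one is `A`, and the next one is the subspace
spanned by all commutators `x y - y x` of elements of the preceding one. -/
def lieSolvablePower : ℕ → Submodule F A
  | 0 => ⊤
  | n + 1 => Submodule.span F
      {c | ∃ x ∈ lieSolvablePower n, ∃ y ∈ lieSolvablePower n, c = x * y - y * x}

/-- `A` is *Lie-solvable* if some Lie-solvable power of `A` vanishes. -/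
def IsLieSolvableAlg : Prop := ∃ n : ℕ, lieSolvablePower F A n = ⊥

/-- An *integral domain* is an associative and commutative (not necessarily unital) algebra with
no nonzero zero divisors. -/
structure IsIntegralDomainAlg (A : Type u) [NonUnitalNonAssocRing A] : Prop where
  mul_assoc : ∀ x y z : A, (x * y) * z = x * (y * z)
  mul_comm : ∀ x y : A, x * y = y * x
  eq_zero_or_eq_zero : ∀ x y : A, x * y = 0 → x = 0 ∨ y = 0

variable [IsScalarTower F A A] [SMulCommClass F A A]

/-- The sum of all trivial ideals of `A`. -/
def sumTrivialIdeals : AlgIdeal F A := AlgIdeal.sum {I | I.IsTrivial}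

/-- The transfinite Baer series of `A`. It starts with `0`; the member at `α + 1` is the preimage
in `A` of the sum of all trivial ideals of the quotient of `A` by the member at `α`; the member at
a limit ordinal is the sum (equivalently the union, see `coe_baerSeries_limit`) of all the
preceding ones. -/
noncomputable def baerSeries (α : Ordinal.{u}) : AlgIdeal F A :=
  Ordinal.limitRecOn α (AlgIdeal.zero F A)
    (fun _ B => B.preimage (sumTrivialIdeals F B.Quotient))
    (fun α _ B => AlgIdeal.sum {I | ∃ (β : Ordinal.{u}) (hβ : β < α), I = B β hβ})

/-- The *Baer radical* of `A`: the member of the Baer series at an ordinal of cardinality greater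
than that of `A` (by `baerSeries_eq_baerRadical`, the choice of this ordinal is irrelevant). -/
noncomputable def baerRadical : AlgIdeal F A :=
  baerSeries F A (Order.succ (Cardinal.mk A)).ord

theorem baerSeries_zero : baerSeries F A 0 = AlgIdeal.zero F A :=
  Ordinal.limitRecOn_zero ..

theorem baerSeries_succ (α : Ordinal.{u}) : baerSeries F A (α + 1) =
    (baerSeries F A α).preimage (sumTrivialIdeals F (baerSeries F A α).Quotient) :=
  Ordinal.limitRecOn_add_one ..

theorem baerSeries_limit {α : Ordinal.{u}} (hα : Order.IsSuccLimit α) : baerSeries F A α =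
    AlgIdeal.sum {I | ∃ (β : Ordinal.{u}) (_ : β < α), I = baerSeries F A β} :=
  Ordinal.limitRecOn_limit _ _ _ _ hα

theorem baerSeries_le_succ (α : Ordinal.{u}) :
    baerSeries F A α ≤ baerSeries F A (α + 1) := by
  rw [baerSeries_succ]
  intro x hx
  rw [AlgIdeal.mem_preimage, (AlgIdeal.proj_eq_zero _ x).2 hx]
  exact Submodule.zero_mem _

theorem baerSeries_mono : Monotone (baerSeries F A) := by
  intro β α
  induction α using Ordinal.limitRecOn with
  | zero =>
    intro h
    rw [nonpos_iff_eq_zero.1 h]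
  | add_one α ih =>
    intro h
    rcases h.lt_or_eq with h | h
    · exact (ih (Order.lt_add_one_iff.1 h)).trans (baerSeries_le_succ F A α)
    · rw [h]
  | limit α hα ih =>
    intro h
    rcases h.lt_or_eq with h | h
    · rw [baerSeries_limit F A hα]
      exact AlgIdeal.le_sum ⟨β, h, rfl⟩
    · rw [h]

theorem coe_baerSeries_limit {α : Ordinal.{u}} (hα : Order.IsSuccLimit α) :
    (baerSeries F A α : Set A) = ⋃ β : Set.Iio α, (baerSeries F A β : Set A) := by
  apply Set.Subset.antisymm
  · intro x hx
    have : Nonempty (Set.Iio α) := ⟨⟨0, pos_iff_ne_zero.2 hα.ne_bot⟩⟩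
    have hd : Directed (· ≤ ·) fun β : Set.Iio α => (baerSeries F A β).toSubmodule :=
      Monotone.directed_le fun β γ h => baerSeries_mono F A h
    rw [baerSeries_limit F A hα] at hx
    have hle : (AlgIdeal.sum {I | ∃ (β : Ordinal.{u}) (_ : β < α), I = baerSeries F A β}).toSubmodule
        ≤ ⨆ β : Set.Iio α, (baerSeries F A β).toSubmodule := by
      refine iSup₂_le ?_
      rintro _ ⟨β, hβ, rfl⟩
      exact le_iSup (fun β : Set.Iio α => (baerSeries F A β).toSubmodule) ⟨β, hβ⟩
    obtain ⟨β, hβ⟩ := (Submodule.mem_iSup_of_directed _ hd).1 (hle hx)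
    exact Set.mem_iUnion.2 ⟨β, hβ⟩
  · exact Set.iUnion_subset fun β => baerSeries_mono F A (le_of_lt β.2)

theorem baerSeries_eq_of_succ_eq {α : Ordinal.{u}}
    (h : baerSeries F A (α + 1) = baerSeries F A α) {δ : Ordinal.{u}} (hδ : α ≤ δ) :
    baerSeries F A δ = baerSeries F A α := by
  induction δ using Ordinal.limitRecOn with
  | zero => rw [nonpos_iff_eq_zero.1 hδ]
  | add_one δ ih =>
    rcases hδ.lt_or_eq with h' | h'
    · rw [baerSeries_succ, ih (Order.lt_add_one_iff.1 h'), ← baerSeries_succ, h]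
    · rw [h']
  | limit δ hlim ih =>
    refine le_antisymm ?_ (baerSeries_mono F A hδ)
    change (baerSeries F A δ : Set A) ⊆ _
    rw [coe_baerSeries_limit F A hlim]
    refine Set.iUnion_subset fun β => ?_
    rcases le_total α β with h' | h'
    · exact (ih β β.2 h').le
    · exact baerSeries_mono F A h'

theorem exists_baerSeries_succ_eq {δ : Ordinal.{u}} (hδ : Cardinal.mk A < δ.card) :
    ∃ α < δ, baerSeries F A (α + 1) = baerSeries F A α := by
  by_contra! hne
  have hex : ∀ α : Set.Iio δ, ∃ x, x ∈ baerSeries F A (α.1 + 1) ∧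
      x ∉ baerSeries F A α.1 := by
    intro α
    by_contra! hx
    exact hne α.1 α.2 (le_antisymm hx (baerSeries_le_succ F A α.1))
  choose f hf hf' using hex
  have key : ∀ α β : Set.Iio δ, α.1 < β.1 → f α ≠ f β := fun α β h he =>
    hf' β (he ▸ baerSeries_mono F A (Order.add_one_le_of_lt h) (hf α))
  have hinj : Function.Injective f := by
    intro α β he
    rcases lt_trichotomy α.1 β.1 with h | h | h
    · exact (key α β h he).elim
    · exact Subtype.ext h
    · exact (key β α h he.symm).elim
  have h := Cardinal.lift_mk_le_lift_mk_of_injective hinj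
  rw [Cardinal.mk_Iio_ordinal, Cardinal.lift_lift, Cardinal.lift_le] at h
  exact absurd hδ (not_lt.2 h)

/-- The Baer series is constant from any ordinal of cardinality greater than that of `A` on. -/
theorem baerSeries_eq_baerRadical {δ : Ordinal.{u}} (hδ : Cardinal.mk A < δ.card) :
    baerSeries F A δ = baerRadical F A := by
  have hδ' : (Order.succ (Cardinal.mk A)).ord ≤ δ :=
    Cardinal.ord_le.2 (Order.succ_le_of_lt hδ)
  obtain ⟨α, hα, h⟩ := exists_baerSeries_succ_eq F A
    (δ := (Order.succ (Cardinal.mk A)).ord) (by simp)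
  rw [baerRadical, baerSeries_eq_of_succ_eq F A h hα.le,
    baerSeries_eq_of_succ_eq F A h (hα.le.trans hδ')]

end

/-!
The Baer radical is the least ideal `B` for which `A / B` is semiprime, that is, has no nonzero
trivial ideals. A quotient that is an integral domain is semiprime, which gives one inclusion.

For the other one, let `A` be semiprime, Lie-solvable and Novikov. As
`2 [a, b] c = [a c, b] + [a, b c]`, the Lie-solvable powers of `A` are ideals. In a semiprime
algebra a commutative ideal is central, and an ideal `J` with `[J, J]` central is commutative,
because then `[J, J]² = 0`. Going down the Lie-solvable powers, `A` is commutative, hence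
associative. Finally `A` and its unitization are reduced, so the prime ideals of the unitization
intersect in `0`, and so do their contractions to `A`.
-/

/-- An algebra is *semiprime* if it has no nonzero trivial ideals. -/
def IsSemiprimeAlg (F : Type v) (A : Type u) [Field F] [NonUnitalNonAssocRing A] [Module F A] :
    Prop :=
  ∀ I : AlgIdeal F A, I.IsTrivial → ∀ x ∈ I, x = 0

section Quotients

variable {F : Type v} {A : Type u} [Field F] [NonUnitalNonAssocRing A] [Module F A]

namespace AlgIdeal

instance : AddSubgroupClass (AlgIdeal F A) A where
  add_mem {I} := I.add_mem'
  zero_mem I := I.zero_mem'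
  neg_mem {I} := I.toSubmodule.neg_mem

instance : SMulMemClass (AlgIdeal F A) F A where
  smul_mem {I} c _ := I.smul_mem' c

/-- The image of an ideal of `A` in the quotient `A / I`. -/
def image (I J : AlgIdeal F A) : AlgIdeal F I.Quotient where
  toSubmodule := J.toSubmodule.map I.proj
  mul_mem_left' := by
    rintro a _ ⟨x, hx, rfl⟩
    obtain ⟨a, rfl⟩ := I.proj_surjective a
    exact ⟨a * x, J.mul_mem_left a hx, rfl⟩
  mul_mem_right' := by
    rintro a _ ⟨x, hx, rfl⟩
    obtain ⟨a, rfl⟩ := I.proj_surjective a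
    exact ⟨x * a, J.mul_mem_right a hx, rfl⟩

theorem le_preimage (I : AlgIdeal F A) (J : AlgIdeal F I.Quotient) : I ≤ I.preimage J := by
  intro x hx
  rw [mem_preimage, (I.proj_eq_zero x).2 hx]
  exact zero_mem J

theorem preimage_le_iff_le_image {I K : AlgIdeal F A} (hIK : I ≤ K) {J : AlgIdeal F I.Quotient} :
    I.preimage J ≤ K ↔ J ≤ I.image K := by
  refine ⟨fun h y hy => ?_, fun h x hx => ?_⟩
  · obtain ⟨x, rfl⟩ := I.proj_surjective y
    exact ⟨x, h hy, rfl⟩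
  · obtain ⟨k, hk, hkx⟩ := h hx
    have hsub : x - k ∈ I := by rw [← proj_eq_zero, map_sub, hkx, sub_self]
    simpa using add_mem (hIK hsub) hk

theorem sum_le [IsScalarTower F A A] [SMulCommClass F A A] {S : Set (AlgIdeal F A)}
    {J : AlgIdeal F A} (h : ∀ I ∈ S, I ≤ J) : sum S ≤ J :=
  (iSup₂_le h : ⨆ I ∈ S, I.toSubmodule ≤ J.toSubmodule)

end AlgIdeal

theorem IsSemiprimeAlg.le_of_mul_mem {I J : AlgIdeal F A} (hI : IsSemiprimeAlg F I.Quotient)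
    (hJ : ∀ x ∈ J, ∀ y ∈ J, x * y ∈ I) : J ≤ I := by
  have htriv : (I.image J).IsTrivial := by
    rintro _ ⟨x, hx, rfl⟩ _ ⟨y, hy, rfl⟩
    exact (I.proj_eq_zero (x * y)).2 (hJ x hx y hy)
  exact fun x hx => (I.proj_eq_zero x).1 (hI _ htriv _ ⟨x, hx, rfl⟩)

theorem IsIntegralDomainAlg.isSemiprimeAlg (hA : IsIntegralDomainAlg A) : IsSemiprimeAlg F A :=
  fun _ hI x hx => or_self_iff.1 (hA.eq_zero_or_eq_zero x x (hI x hx x hx))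

theorem map_proj_lieSolvablePower (I : AlgIdeal F A) (n : ℕ) :
    (lieSolvablePower F A n).map I.proj = lieSolvablePower F I.Quotient n := by
  induction n with
  | zero => exact Submodule.map_top _ |>.trans (LinearMap.range_eq_top.2 I.proj_surjective)
  | succ n ih =>
    rw [lieSolvablePower, lieSolvablePower, Submodule.map_span, ← ih]
    congr 1
    ext c
    constructor
    · rintro ⟨_, ⟨x, hx, y, hy, rfl⟩, rfl⟩
      exact ⟨_, ⟨x, hx, rfl⟩, _, ⟨y, hy, rfl⟩, map_sub ..⟩
    · rintro ⟨_, ⟨x, hx, rfl⟩, _, ⟨y, hy, rfl⟩, rfl⟩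
      exact ⟨_, ⟨x, hx, y, hy, rfl⟩, map_sub ..⟩

theorem IsLieSolvableAlg.quotient (hA : IsLieSolvableAlg F A) (I : AlgIdeal F A) :
    IsLieSolvableAlg F I.Quotient :=
  hA.imp fun n hn => by rw [← map_proj_lieSolvablePower, hn, Submodule.map_bot]

end Quotients

section BaerRadical

variable {F : Type v} {A : Type u} [Field F] [NonUnitalNonAssocRing A] [Module F A]
  [IsScalarTower F A A] [SMulCommClass F A A]

theorem baerSeries_le_of_isSemiprimeAlg_quotient {I : AlgIdeal F A}
    (hI : IsSemiprimeAlg F I.Quotient) (α : Ordinal.{u}) : baerSeries F A α ≤ I := by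
  induction α using Ordinal.limitRecOn with
  | zero =>
    rw [baerSeries_zero]
    rintro _ rfl
    exact zero_mem I
  | add_one α ih =>
    rw [baerSeries_succ, AlgIdeal.preimage_le_iff_le_image ih]
    refine AlgIdeal.sum_le fun J hJ => (AlgIdeal.preimage_le_iff_le_image ih).1 ?_
    refine hI.le_of_mul_mem fun x hx y hy => ih ?_
    exact (AlgIdeal.proj_eq_zero _ _).1 (hJ _ hx _ hy)
  | limit α hα ih =>
    rw [baerSeries_limit F A hα]
    refine AlgIdeal.sum_le ?_
    rintro _ ⟨β, hβ, rfl⟩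
    exact ih β hβ

variable (F A)

theorem preimage_sumTrivialIdeals_baerRadical :
    (baerRadical F A).preimage (sumTrivialIdeals F (baerRadical F A).Quotient) =
      baerRadical F A := by
  let δ := (Order.succ (Cardinal.mk A)).ord
  have hδ : Cardinal.mk A < (δ + 1).card := by
    calc Cardinal.mk A < δ.card := by simp [δ]
      _ ≤ (δ + 1).card := Ordinal.card_le_card le_self_add
  calc _ = baerSeries F A (δ + 1) := (baerSeries_succ F A δ).symm
    _ = baerRadical F A := baerSeries_eq_baerRadical F A hδ

theorem isSemiprimeAlg_quotient_baerRadical : IsSemiprimeAlg F (baerRadical F A).Quotient := by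
  intro J hJ x hx
  obtain ⟨a, rfl⟩ := (baerRadical F A).proj_surjective x
  rw [AlgIdeal.proj_eq_zero, ← preimage_sumTrivialIdeals_baerRadical, AlgIdeal.mem_preimage]
  exact AlgIdeal.le_sum (S := {I | I.IsTrivial}) hJ hx

theorem isLeast_baerRadical :
    IsLeast {I : AlgIdeal F A | IsSemiprimeAlg F I.Quotient} (baerRadical F A) :=
  ⟨isSemiprimeAlg_quotient_baerRadical F A,
    fun _ hI => baerSeries_le_of_isSemiprimeAlg_quotient hI _⟩

end BaerRadical

namespace IsNovikov

variable {A : Type u} [NonUnitalNonAssocRing A] [IsNovikov A]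

variable (A) in
/-- A Novikov algebra, regarded as a left pre-Lie ring with the same multiplication; this makes
its commutators a Lie bracket. -/
abbrev leftPreLieRing : LeftPreLieRing A where
  __ := ‹NonUnitalNonAssocRing A›
  assoc_symm' := associator_left_symm

theorem leibniz_lie (a x y : A) : ⁅a, ⁅x, y⁆⁆ = ⁅⁅a, x⁆, y⁆ + ⁅x, ⁅a, y⁆⁆ :=
  letI := leftPreLieRing A
  _root_.leibniz_lie a x y

theorem lie_mul_add_lie_mul (a b c : A) : ⁅a, b⁆ * c + ⁅a, b⁆ * c = ⁅a * c, b⁆ + ⁅a, b * c⁆ := by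
  have hsymm := associator_left_symm a b c
  have hab := mul_right_comm a b c
  have hba := mul_right_comm b a c
  simp only [associator_apply] at hsymm
  simp only [Ring.lie_def, sub_mul]
  grind

theorem mul_assoc_of_commute {x y z : A} (hxy : Commute x y) (hxyz : Commute x (y * z)) :
    (x * y) * z = x * (y * z) := by
  rw [hxy.eq, mul_right_comm, hxyz.eq]

/-- A commutative Novikov algebra, regarded as a nonunital commutative ring with the same
multiplication. -/
abbrev nonUnitalCommRing (hA : ∀ x y : A, Commute x y) : NonUnitalCommRing A where
  __ := ‹NonUnitalNonAssocRing A›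
  mul_assoc x y z := mul_assoc_of_commute (hA x y) (hA x (y * z))
  mul_comm x y := (hA x y).eq

instance {F : Type v} [Field F] [Module F A] (I : AlgIdeal F A) : IsNovikov I.Quotient where
  associator_left_symm x y z := by
    obtain ⟨x, rfl⟩ := I.proj_surjective x
    obtain ⟨y, rfl⟩ := I.proj_surjective y
    obtain ⟨z, rfl⟩ := I.proj_surjective z
    exact congrArg I.proj (associator_left_symm x y z)
  mul_right_comm x y z := by
    obtain ⟨x, rfl⟩ := I.proj_surjective x
    obtain ⟨y, rfl⟩ := I.proj_surjective y
    obtain ⟨z, rfl⟩ := I.proj_surjective z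
    exact congrArg I.proj (mul_right_comm x y z)

end IsNovikov

namespace AlgIdeal

variable {F : Type v} {A : Type u} [Field F] [NonUnitalNonAssocRing A] [Module F A]

/-- An ideal is *commutative* if its elements commute with each other. -/
def IsCommutative (I : AlgIdeal F A) : Prop :=
  ∀ x ∈ I, ∀ y ∈ I, Commute x y

theorem lie_mem_right (I : AlgIdeal F A) (a : A) {x : A} (hx : x ∈ I) : ⁅a, x⁆ ∈ I :=
  sub_mem (I.mul_mem_left a hx) (I.mul_mem_right a hx)

/-- The annihilator of a commutative ideal of a Novikov algebra inside that ideal. -/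
def selfAnnihilator [IsScalarTower F A A] [IsNovikov A] (I : AlgIdeal F A)
    (hI : I.IsCommutative) : AlgIdeal F A where
  carrier := {x | x ∈ I ∧ ∀ y ∈ I, x * y = 0}
  add_mem' := fun ⟨hx, hx₀⟩ ⟨hy, hy₀⟩ =>
    ⟨add_mem hx hy, fun z hz => by rw [add_mul, hx₀ z hz, hy₀ z hz, add_zero]⟩
  zero_mem' := ⟨zero_mem I, fun y _ => zero_mul y⟩
  smul_mem' c _ := fun ⟨hx, hx₀⟩ =>
    ⟨SMulMemClass.smul_mem c hx, fun y hy => by rw [smul_mul_assoc, hx₀ y hy, smul_zero]⟩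
  mul_mem_left' a x := fun ⟨hx, hx₀⟩ => ⟨I.mul_mem_left a hx, fun y hy => by
    have hay : a * y ∈ I := I.mul_mem_left a hy
    rw [IsNovikov.mul_right_comm, (hI _ hay x hx).eq, hx₀ _ hay]⟩
  mul_mem_right' a x := fun ⟨hx, hx₀⟩ => ⟨I.mul_mem_right a hx, fun y hy => by
    rw [IsNovikov.mul_right_comm, hx₀ y hy, zero_mul]⟩

section Commutator

/-- The subspace spanned by the commutators of elements of `U` with elements of `V`. -/
def commutatorSpan (U V : Submodule F A) : Submodule F A :=
  Submodule.span F {c | ∃ x ∈ U, ∃ y ∈ V, c = ⁅x, y⁆}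

theorem lie_mem_commutatorSpan {U V : Submodule F A} {x y : A} (hx : x ∈ U) (hy : y ∈ V) :
    ⁅x, y⁆ ∈ commutatorSpan U V :=
  Submodule.subset_span ⟨x, hx, y, hy, rfl⟩

theorem commutatorSpan_le {U V W : Submodule F A} :
    commutatorSpan U V ≤ W ↔ ∀ x ∈ U, ∀ y ∈ V, ⁅x, y⁆ ∈ W := by
  refine ⟨fun h x hx y hy => h (lie_mem_commutatorSpan hx hy), fun h => Submodule.span_le.2 ?_⟩
  rintro _ ⟨x, hx, y, hy, rfl⟩
  exact h x hx y hy

variable [IsNovikov A] [NeZero (2 : F)]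

theorem lie_mul_mem_commutatorSpan {I J : AlgIdeal F A} {x y : A} (hx : x ∈ I) (hy : y ∈ J)
    (a : A) : ⁅x, y⁆ * a ∈ commutatorSpan I.toSubmodule J.toSubmodule := by
  rw [← Submodule.smul_mem_iff _ (two_ne_zero (α := F)), two_smul, IsNovikov.lie_mul_add_lie_mul]
  exact add_mem (lie_mem_commutatorSpan (I.mul_mem_right a hx) hy)
    (lie_mem_commutatorSpan hx (J.mul_mem_right a hy))

theorem mul_lie_mem_commutatorSpan {I J : AlgIdeal F A} {x y : A} (hx : x ∈ I) (hy : y ∈ J)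
    (a : A) : a * ⁅x, y⁆ ∈ commutatorSpan I.toSubmodule J.toSubmodule := by
  have hlie : a * ⁅x, y⁆ = ⁅x, y⁆ * a + (⁅⁅a, x⁆, y⁆ + ⁅x, ⁅a, y⁆⁆) := by
    rw [← IsNovikov.leibniz_lie, Ring.lie_def a, add_sub_cancel]
  rw [hlie]
  exact add_mem (lie_mul_mem_commutatorSpan hx hy a) (add_mem
    (lie_mem_commutatorSpan (I.lie_mem_right a hx) hy)
    (lie_mem_commutatorSpan hx (J.lie_mem_right a hy)))

variable [IsScalarTower F A A] [SMulCommClass F A A]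

/-- The subspace spanned by the commutators of elements of `I` with elements of `J`, as an ideal
of a Novikov algebra in characteristic different from `2`. -/
def commutator (I J : AlgIdeal F A) : AlgIdeal F A where
  toSubmodule := commutatorSpan I.toSubmodule J.toSubmodule
  mul_mem_left' a _ hc :=
    have hle : commutatorSpan I.toSubmodule J.toSubmodule ≤
        (commutatorSpan I.toSubmodule J.toSubmodule).comap (LinearMap.mulLeft F a) :=
      commutatorSpan_le.2 fun _ hx _ hy => mul_lie_mem_commutatorSpan hx hy a
    hle hc
  mul_mem_right' a _ hc :=
    have hle : commutatorSpan I.toSubmodule J.toSubmodule ≤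
        (commutatorSpan I.toSubmodule J.toSubmodule).comap (LinearMap.mulRight F a) :=
      commutatorSpan_le.2 fun _ hx _ hy => lie_mul_mem_commutatorSpan hx hy a
    hle hc

variable (F A) in
/-- The Lie-solvable powers of a Novikov algebra, as ideals. -/
def lieSolvableIdeal : ℕ → AlgIdeal F A
  | 0 => { toSubmodule := ⊤, mul_mem_left' _ _ _ := trivial, mul_mem_right' _ _ _ := trivial }
  | n + 1 => (lieSolvableIdeal n).commutator (lieSolvableIdeal n)

theorem lieSolvableIdeal_toSubmodule (n : ℕ) :
    (lieSolvableIdeal F A n).toSubmodule = lieSolvablePower F A n := by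
  induction n with
  | zero => rfl
  | succ n ih => rw [lieSolvablePower, ← ih]; rfl

end Commutator

end AlgIdeal

namespace IsSemiprimeAlg

section Novikov

variable {F : Type v} {A : Type u} [Field F] [NonUnitalNonAssocRing A] [Module F A]
  [IsScalarTower F A A] [IsNovikov A] {I J : AlgIdeal F A}

theorem eq_zero_of_forall_mul_eq_zero (hA : IsSemiprimeAlg F A) (hI : I.IsCommutative) {x : A}
    (hx : x ∈ I) (hx₀ : ∀ y ∈ I, x * y = 0) : x = 0 :=
  hA (I.selfAnnihilator hI) (fun _ hy _ hz => hy.2 _ hz.1) x ⟨hx, hx₀⟩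

variable [NeZero (2 : F)]

theorem commute_of_isCommutative (hA : IsSemiprimeAlg F A) (hI : I.IsCommutative) (a : A) {x : A}
    (hx : x ∈ I) : Commute a x := by
  have two_smul_lie_mul : ∀ y ∈ I, ∀ z ∈ I, (2 : F) • (⁅a, y⁆ * z) = ⁅a, y * z⁆ := by
    intro y hy z hz
    have haz : ⁅a * z, y⁆ = 0 := commute_iff_lie_eq.1 (hI _ (I.mul_mem_left a hz) y hy)
    rw [two_smul, IsNovikov.lie_mul_add_lie_mul, haz, zero_add]
  have mul_assoc_of_mem : ∀ y ∈ I, ∀ z ∈ I, ∀ w, (y * z) * w = y * (z * w) := fun y hy z hz w =>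
    IsNovikov.mul_assoc_of_commute (hI y hy z hz) (hI y hy _ (I.mul_mem_right w hz))
  have hmem : ⁅a, x⁆ ∈ I := I.lie_mem_right a hx
  -- Both ways of expanding `[a, x y z]` give multiples of `([a, x] y) z`: by `4` and by `2`.
  have lie_mul_mul : ∀ y ∈ I, ∀ z ∈ I, (⁅a, x⁆ * y) * z = 0 := by
    intro y hy z hz
    have h : (2 : F) • (2 : F) • ((⁅a, x⁆ * y) * z) = (2 : F) • ((⁅a, x⁆ * y) * z) := by
      calc (2 : F) • (2 : F) • ((⁅a, x⁆ * y) * z)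
          = (2 : F) • (⁅a, x * y⁆ * z) := by rw [← two_smul_lie_mul x hx y hy, smul_mul_assoc]
        _ = ⁅a, x * (y * z)⁆ := by
          rw [two_smul_lie_mul _ (I.mul_mem_right y hx) z hz, mul_assoc_of_mem x hx y hy]
        _ = (2 : F) • ((⁅a, x⁆ * y) * z) := by
          rw [← two_smul_lie_mul x hx _ (I.mul_mem_right z hy), mul_assoc_of_mem _ hmem y hy]
    have h' := smul_right_injective A (two_ne_zero (α := F)) h
    rwa [two_smul, add_eq_left] at h'
  refine commute_iff_lie_eq.2 (hA.eq_zero_of_forall_mul_eq_zero hI hmem fun y hy => ?_)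
  exact hA.eq_zero_of_forall_mul_eq_zero hI (I.mul_mem_right y hmem) (lie_mul_mul y hy)

variable [SMulCommClass F A A]

theorem isCommutative_of_commutator (hA : IsSemiprimeAlg F A)
    (hJ : (J.commutator J).IsCommutative) : J.IsCommutative := by
  have htriv : (J.commutator J).IsTrivial := by
    intro c hc i hi
    suffices (J.commutator J).toSubmodule ≤ LinearMap.ker (LinearMap.mulRight F i) from this hc
    refine AlgIdeal.commutatorSpan_le.2 fun a _ b _ => ?_
    have hcomm : (a * b) * i = (b * a) * i := by
      calc (a * b) * i = (i * a) * b := by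
            rw [IsNovikov.mul_right_comm, (hA.commute_of_isCommutative hJ a hi).eq]
        _ = (b * i) * a := by
            rw [IsNovikov.mul_right_comm, (hA.commute_of_isCommutative hJ b hi).eq]
        _ = (b * a) * i := IsNovikov.mul_right_comm ..
    rw [LinearMap.mem_ker, LinearMap.mulRight_apply, Ring.lie_def, sub_mul, hcomm, sub_self]
  exact fun a ha b hb =>
    commute_iff_lie_eq.2 (hA _ htriv _ (AlgIdeal.lie_mem_commutatorSpan ha hb))

theorem commute_of_isLieSolvableAlg (hA : IsSemiprimeAlg F A) (hs : IsLieSolvableAlg F A)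
    (x y : A) : Commute x y := by
  obtain ⟨n, hn⟩ := hs
  have hlast : (AlgIdeal.lieSolvableIdeal F A n).IsCommutative := by
    intro x hx y _
    rw [← AlgIdeal.mem_toSubmodule, AlgIdeal.lieSolvableIdeal_toSubmodule, hn,
      Submodule.mem_bot] at hx
    exact hx ▸ Commute.zero_left y
  have hfirst : (AlgIdeal.lieSolvableIdeal F A 0).IsCommutative :=
    Nat.decreasingInduction (motive := fun m _ => (AlgIdeal.lieSolvableIdeal F A m).IsCommutative)
      (fun _ _ => hA.isCommutative_of_commutator) hlast n.zero_le
  exact hfirst x trivial y trivial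

end Novikov

end IsSemiprimeAlg

theorem isReduced_unitization {R : Type*} {A : Type*} [CommSemiring R] [IsReduced R]
    [NonUnitalSemiring A] [Module R A] [IsScalarTower R A A] [SMulCommClass R A A]
    (hA : ∀ x : A, x * x = 0 → x = 0) : IsReduced (Unitization R A) := by
  refine (isReduced_iff_pow_one_lt 2 one_lt_two).2 fun x hx => ?_
  rw [sq] at hx
  have hfst : x.fst = 0 := by
    refine IsNilpotent.eq_zero ⟨2, ?_⟩
    rw [sq, ← Unitization.fst_mul, hx, Unitization.fst_zero]
  have hsnd : x.snd = 0 := by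
    refine hA _ ?_
    simpa only [Unitization.snd_mul, Unitization.snd_zero, hfst, zero_smul, zero_add]
      using congrArg (·.snd) hx
  exact Unitization.ext hfst hsnd

section Commutative

variable {F : Type v} {A : Type u} [Field F] [NonUnitalCommRing A] [Module F A]
  [IsScalarTower F A A] [SMulCommClass F A A]

/-- The contraction to `A` of an ideal of the unitization of `A`. -/
def AlgIdeal.contraction (P : Ideal (Unitization F A)) : AlgIdeal F A where
  toSubmodule := (P.restrictScalars F).comap (Unitization.inrHom F F A)
  mul_mem_left' a x hx := by
    have h : (a : Unitization F A) * (x : Unitization F A) ∈ P := P.mul_mem_left _ hx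
    rwa [← Unitization.inr_mul] at h
  mul_mem_right' a x hx := by
    have h : (x : Unitization F A) * (a : Unitization F A) ∈ P := P.mul_mem_right _ hx
    rwa [← Unitization.inr_mul] at h

namespace IsSemiprimeAlg

theorem eq_zero_of_mul_self_eq_zero (hA : IsSemiprimeAlg F A) {x : A} (hx : x * x = 0) :
    x = 0 := by
  refine hA (AlgIdeal.contraction (Ideal.span {(x : Unitization F A)})) (fun y hy z hz => ?_) x
    (Ideal.mem_span_singleton_self _)
  have hdvd : (x : Unitization F A) * x ∣ y * z :=
    mul_dvd_mul (Ideal.mem_span_singleton.1 hy) (Ideal.mem_span_singleton.1 hz)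
  rw [← Unitization.inr_mul, ← Unitization.inr_mul, hx, Unitization.inr_zero, zero_dvd_iff] at hdvd
  exact Unitization.inr_injective hdvd

theorem exists_prime_notMem (hA : IsSemiprimeAlg F A) {x : A} (hx : x ≠ 0) :
    ∃ P : AlgIdeal F A, (∀ y z : A, y * z ∈ P → y ∈ P ∨ z ∈ P) ∧ x ∉ P := by
  have hred : IsReduced (Unitization F A) :=
    isReduced_unitization fun _ => hA.eq_zero_of_mul_self_eq_zero
  have hnil : ¬ IsNilpotent (x : Unitization F A) := by
    rwa [isNilpotent_iff_eq_zero, ← Unitization.inr_zero F, Unitization.inr_injective.eq_iff]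
  rw [nilpotent_iff_mem_prime] at hnil
  push Not at hnil
  obtain ⟨P, hP, hxP⟩ := hnil
  refine ⟨AlgIdeal.contraction P, fun y z hyz => hP.mem_or_mem ?_, hxP⟩
  exact Unitization.inr_mul F y z ▸ hyz

end IsSemiprimeAlg

end Commutative

section IntegralDomainQuotients

variable {F : Type v} {A : Type u} [Field F] [NonUnitalNonAssocRing A] [Module F A]
  [IsNovikov A] {I : AlgIdeal F A}

theorem isIntegralDomainAlg_quotient (hcomm : ∀ x y : A, ⁅x, y⁆ ∈ I)
    (hprime : ∀ x y : A, x * y ∈ I → x ∈ I ∨ y ∈ I) : IsIntegralDomainAlg I.Quotient := by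
  have hcomm' : ∀ x y : I.Quotient, Commute x y := by
    intro x y
    obtain ⟨x, rfl⟩ := I.proj_surjective x
    obtain ⟨y, rfl⟩ := I.proj_surjective y
    exact commute_iff_lie_eq.2 ((I.proj_eq_zero _).2 (hcomm x y))
  refine ⟨fun x y z => IsNovikov.mul_assoc_of_commute (hcomm' x y) (hcomm' x _), hcomm',
    fun x y hxy => ?_⟩
  obtain ⟨x, rfl⟩ := I.proj_surjective x
  obtain ⟨y, rfl⟩ := I.proj_surjective y
  rw [← AlgIdeal.proj_mul, AlgIdeal.proj_eq_zero] at hxy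
  simpa only [AlgIdeal.proj_eq_zero] using hprime x y hxy

theorem exists_isIntegralDomainAlg_quotient_notMem [IsScalarTower F A A] [SMulCommClass F A A]
    (hI : IsSemiprimeAlg F I.Quotient) (hcomm : ∀ x y : I.Quotient, Commute x y) {x : A}
    (hx : x ∉ I) : ∃ J : AlgIdeal F A, IsIntegralDomainAlg J.Quotient ∧ x ∉ J := by
  obtain ⟨P, hprime, hxP⟩ : ∃ P : AlgIdeal F I.Quotient,
      (∀ y z, y * z ∈ P → y ∈ P ∨ z ∈ P) ∧ I.proj x ∉ P :=
    letI := IsNovikov.nonUnitalCommRing hcomm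
    hI.exists_prime_notMem (mt (I.proj_eq_zero x).1 hx)
  refine ⟨I.preimage P, isIntegralDomainAlg_quotient (fun a b => I.le_preimage P ?_)
    fun a b => hprime (I.proj a) (I.proj b), hxP⟩
  exact (I.proj_eq_zero _).1 (commute_iff_lie_eq.1 (hcomm (I.proj a) (I.proj b)))

end IntegralDomainQuotients

/-- In a Lie-solvable Novikov algebra `A` over a field of characteristic different from `2`, the
Baer radical is the intersection of all ideals `I` such that `A / I` is an integral domain. -/
theorem corollary1 (F : Type v) (A : Type u) [Field F] (hF : ringChar F ≠ 2)
    [NonUnitalNonAssocRing A] [Module F A] [IsScalarTower F A A] [SMulCommClass F A A]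
    [IsNovikov A] (hA : IsLieSolvableAlg F A) :
    (baerRadical F A : Set A) =
      ⋂ (I : AlgIdeal F A) (_ : IsIntegralDomainAlg I.Quotient), (I : Set A) := by
  have : NeZero (2 : F) := ⟨Ring.two_ne_zero hF⟩
  obtain ⟨hsemiprime, hleast⟩ := isLeast_baerRadical F A
  refine Set.Subset.antisymm
    (Set.subset_iInter₂ fun I hI => hleast hI.isSemiprimeAlg) fun x hx => ?_
  by_contra hxB
  have hcomm := hsemiprime.commute_of_isLieSolvableAlg (hA.quotient (baerRadical F A))
  obtain ⟨J, hJ, hxJ⟩ := exists_isIntegralDomainAlg_quotient_notMem hsemiprime hcomm hxB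
  exact hxJ (Set.mem_iInter₂.1 hx J hJ)
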